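/- Let $X$ be a locally convex Hausdorff real topological vector space with topological dual $X^*$, and let $\Gamma(X)$ denote the set of proper, convex, lower semicontinuous functions $X\to\mathbb{R}\cup\{\pm\infty\}$. Let $f\in\Gamma(X)$ and let $C\subset X$ be nonempty, closed and convex. Let $T$ be a finite set and, for each $t\in T$, let $U_t$ be a compact convex subset of some real topological vector space and let $g_t\colon X\times U_t\to\mathbb{R}\cup\{\pm\infty\}$ be such that - $g_t(\cdot,u_t)\in\Gamma(X)$ for every $u_t\in U_t$; - for every $x\in C\cap\operatorname{dom} f$, where $\operatorname{dom} f=\{x: f(x)\neq+\infty\}$, the function $-g_t(x,\cdot)$ is proper, convex and lower semicontinuous on $U_t$. Put $\mathcal{U}=\prod_{t\in T}U_t$ and $A=\{x\in C:\ g_t(x,u_t)\le 0\ \ \forall u_t\in U_t,\ \forall t\in T\}$, and assume that $A\cap\operatorname{dom} f\neq\emptyset$. Assume moreover the Slater-type condition: for every $u=(u_t)_{t\in T}\in\mathcal{U}$ there is $x_u\in C\cap\operatorname{dom} f$ with $g_t(x_u,u_t)<0$ for all $t\in T$. Then robust strong stable duality holds between the robust problem $\inf\{f(x): x\in A\}$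 and its Lagrange dual, i.e. for every $x^*\in X^*$, $$\inf_{x\in A}\bigl[f(x)-\langle x^*,x\rangle\bigr]=\max_{\lambda\in\mathbb{R}_+^T,\ u\in\mathcal{U}}\ \inf_{x\in C}\Bigl(f(x)-\langle x^*,x\rangle+\sum_{t\in T}\lambda_t\,g_t(x,u_t)\Bigr),$$ where the values lie in $\mathbb{R}\cup\{\pm\infty\}$ and the maximum is attained. -/

import Mathlib

namespace RobustConvex

/-- `GammaOn D f`: the restriction to `D` of the extended-real-valued function `f` belongs to
`Γ(D)`, i.e. it is proper, convex (its epigraph is a convex set) and lower semicontinuous on `D`.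
Values of `f` outside `D` play no role; `Γ(X)` is the case `D = Set.univ`. -/
structure GammaOn {V : Type*} [AddCommGroup V] [Module ℝ V] [TopologicalSpace V]
    (D : Set V) (f : V → EReal) : Prop where
  dom_nonempty : ∃ x ∈ D, f x ≠ ⊤
  ne_bot : ∀ x ∈ D, f x ≠ ⊥
  convex_epi : Convex ℝ {p : V × ℝ | p.1 ∈ D ∧ f p.1 ≤ (p.2 : EReal)}
  lsc : LowerSemicontinuousOn f D

/-- The effective domain `{x | f x ≠ +∞}`. -/
def dom {V : Type*} (f : V → EReal) : Set V := {x | f x ≠ ⊤}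

section Problem

variable {X : Type*} [AddCommGroup X] [Module ℝ X] [TopologicalSpace X]
  {T : Type*} {E : T → Type*}

/-- The robust feasible set `{x ∈ C | g t x v ≤ 0 for all t and all v ∈ U t}`. -/
def feasibleSet (C : Set X) (U : ∀ t, Set (E t)) (g : ∀ t, X → E t → EReal) : Set X :=
  {x | x ∈ C ∧ ∀ t, ∀ v ∈ U t, g t x v ≤ 0}

/-- The optimal value of the robust problem whose objective is perturbed by the continuous linear
functional `xs`: the infimum of `f x - ⟨xs, x⟩` over the robust feasible set. -/
noncomputable def primalValue (f : X → EReal) (C : Set X) (U : ∀ t, Set (E t))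
    (g : ∀ t, X → E t → EReal) (xs : X →L[ℝ] ℝ) : EReal :=
  ⨅ x ∈ feasibleSet C U g, (f x - ((xs x : ℝ) : EReal))

/-- The objective of the Lagrange dual of the perturbed problem at the multiplier `lam` and the
scenario `u`: the infimum over `x ∈ C` of `f x - ⟨xs, x⟩ + ∑ t, lam t * g t x (u t)`. -/
noncomputable def dualObjective [Fintype T] (f : X → EReal) (C : Set X)
    (g : ∀ t, X → E t → EReal) (xs : X →L[ℝ] ℝ) (lam : T → ℝ) (u : ∀ t, E t) : EReal :=
  ⨅ x ∈ C, (f x - ((xs x : ℝ) : EReal) + ∑ t, ((lam t : ℝ) : EReal) * g t x (u t))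

/-- Robust strong stable duality: for every continuous linear functional `xs`, the value of the
perturbed robust problem is the maximum (an attained supremum) of the dual objective over all
nonnegative multipliers and all scenarios in the product of the uncertainty sets. -/
def RobustStrongStableDuality [Fintype T] (f : X → EReal) (C : Set X) (U : ∀ t, Set (E t))
    (g : ∀ t, X → E t → EReal) : Prop :=
  ∀ xs : X →L[ℝ] ℝ,
    IsGreatest
      {d : EReal | ∃ (lam : T → ℝ) (u : ∀ t, E t),
        (∀ t, 0 ≤ lam t) ∧ (∀ t, u t ∈ U t) ∧ d = dualObjective f C g xs lam u}
      (primalValue f C U g xs)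

end Problem

end RobustConvex

/-! Weak duality is immediate, and a primal value `⊥` is matched by any multiplier. If the value is
a real `m`, each `x` in `C ∩ dom f` either satisfies `f x - xs x - m ≥ 0` or violates some
constraint. So some weighting of this shifted objective and the constraints, in some scenario, is
nonnegative at `x`. A minimax argument over the compact set simplex × scenarios
(`exists_forall_nonneg_of_concavelike`) makes the choice independent of `x`. The weighted sum need
not be jointly concave in weights and scenario, but merging scenarios coordinatewise
(`exists_merge_of_convex`) gives the concave-like inequality that suffices. Slater makes the
objective's weight positive, and dividing by it gives `lam`. -/

namespace RobustConvex

open Set Filter Topology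

/-! ### Minimax by finite-dimensional separation -/

/-- A Ky Fan type alternative: for `F` convex in `x`, concave-like and upper semicontinuous in `k`
on a compact set, a nonnegative value for every `x` can be achieved by a single `k`. -/
theorem exists_forall_nonneg_of_concavelike {X Y : Type*} [AddCommGroup X] [Module ℝ X]
    [TopologicalSpace Y] {D : Set X} {K : Set Y} {F : X → Y → ℝ}
    (hK : IsCompact K) (hne : K.Nonempty)
    (hconv : ∀ k ∈ K, ConvexOn ℝ D (fun x => F x k))
    (husc : ∀ x ∈ D, UpperSemicontinuousOn (F x) K)
    (hconc : ∀ k ∈ K, ∀ l ∈ K, ∀ a b : ℝ, 0 ≤ a → 0 ≤ b → a + b = 1 →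
      ∃ j ∈ K, ∀ x ∈ D, a * F x k + b * F x l ≤ F x j)
    (h : ∀ x ∈ D, ∃ k ∈ K, 0 ≤ F x k) :
    ∃ k ∈ K, ∀ x ∈ D, 0 ≤ F x k := by
  classical
  by_contra! hcon
  choose! x hxD hx using hcon
  -- Halving the negative value leaves a margin: it puts `0` inside the open orthant `Q` below,
  -- which makes the separation constant `u` positive.
  obtain ⟨s, hsK, hs⟩ := hK.elim_nhdsWithin_subcover
    (fun k => {k' | F (x k) k' < F (x k) k / 2}) (fun k hk => by
      have h1 := hx k hk
      exact husc (x k) (hxD k hk) k hk _ (by linarith))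
  let Q : Set (s → ℝ) := {z | ∀ i : s, F (x i) i / 2 < z i}
  let S : Set (s → ℝ) := {z | ∃ k ∈ K, ∀ i : s, z i ≤ F (x i) k}
  have hQ0 : (0 : s → ℝ) ∈ Q := fun i => by
    have := hx i (hsK i i.2)
    simp only [Pi.zero_apply]
    linarith
  have hQpi : Q = Set.pi univ (fun i : s => Ioi (F (x i) i / 2)) := by
    ext z
    simp [Q]
  have hQo : IsOpen Q := by
    rw [hQpi]
    exact isOpen_set_pi finite_univ fun i _ => isOpen_Ioi
  have hQc : Convex ℝ Q := by
    rw [hQpi]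
    exact convex_pi fun i _ => convex_Ioi _
  have hSc : Convex ℝ S := by
    rintro z ⟨k, hk, hz⟩ z' ⟨l, hl, hz'⟩ a b ha hb hab
    obtain ⟨j, hj, hle⟩ := hconc k hk l hl a b ha hb hab
    refine ⟨j, hj, fun i => le_trans ?_ (hle (x i) (hxD i (hsK i i.2)))⟩
    exact add_le_add (mul_le_mul_of_nonneg_left (hz i) ha) (mul_le_mul_of_nonneg_left (hz' i) hb)
  have hdisj : Disjoint Q S := by
    rw [Set.disjoint_left]
    rintro z hzQ ⟨k, hk, hz⟩
    obtain ⟨i, hi, hki⟩ := mem_iUnion₂.1 (hs hk)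
    exact absurd ((hzQ ⟨i, hi⟩).trans_le (hz ⟨i, hi⟩)) (not_lt.2 (le_of_lt hki))
  obtain ⟨p, u, hpQ, hpS⟩ := geometric_hahn_banach_open hQc hQo hSc hdisj
  have hu : 0 < u := by simpa using hpQ 0 hQ0
  -- `Q` is closed upwards, so a positive coefficient would let `p` reach the value `u` on `Q`.
  have hp : ∀ i, p (Pi.single i 1) ≤ 0 := by
    intro i
    by_contra! hpos
    have hmem : (u / p (Pi.single i 1)) • (Pi.single i 1 : s → ℝ) ∈ Q := by
      intro j
      have h0 : F (x j) j / 2 < 0 := hQ0 j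
      refine h0.trans_le ?_
      by_cases hij : j = i
      · subst hij
        simpa using (div_pos hu hpos).le
      · simp [hij]
    have h1 := hpQ _ hmem
    rw [map_smul, smul_eq_mul, div_mul_cancel₀ _ hpos.ne'] at h1
    exact lt_irrefl _ h1
  have hsum : ∀ z : s → ℝ, p z = ∑ i, z i * p (Pi.single i 1) := by
    intro z
    conv_lhs => rw [pi_eq_sum_univ' z]
    simp only [map_sum, map_smul, smul_eq_mul]
  have hval : ∀ k ∈ K, ∑ i : s, (-p (Pi.single i 1)) * F (x i) k ≤ -u := by
    intro k hk
    have h1 := hpS (fun i => F (x i) k) ⟨k, hk, fun i => le_rfl⟩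
    rw [hsum] at h1
    have : ∑ i : s, (-p (Pi.single i 1)) * F (x i) k
        = - ∑ i : s, F (x i) k * p (Pi.single i 1) := by
      rw [← Finset.sum_neg_distrib]
      exact Finset.sum_congr rfl fun i _ => by ring
    linarith
  -- The normalised weights `-p eᵢ / P` average the points `x i`; by Jensen, `F` at that average is
  -- negative for every `k ∈ K`, contradicting `h`.
  set P : ℝ := ∑ i : s, (-p (Pi.single i 1)) with hP
  have hPnn : 0 ≤ P := Finset.sum_nonneg fun i _ => neg_nonneg.2 (hp i)
  have hPpos : 0 < P := by
    refine hPnn.lt_of_ne' fun hP0 => ?_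
    have hz := (Finset.sum_eq_zero_iff_of_nonneg
      (fun i _ => neg_nonneg.2 (hp i))).1 (hP.symm.trans hP0)
    obtain ⟨k, hk⟩ := hne
    have h1 := hval k hk
    rw [Finset.sum_eq_zero fun i hi => by rw [hz i hi, zero_mul]] at h1
    linarith
  have hw0 : ∀ i ∈ (Finset.univ : Finset s), 0 ≤ -p (Pi.single i 1) / P :=
    fun i _ => div_nonneg (neg_nonneg.2 (hp i)) hPnn
  have hw1 : ∑ i : s, -p (Pi.single i 1) / P = 1 := by
    rw [← Finset.sum_div, ← hP, div_self hPpos.ne']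
  have hxs : ∀ i ∈ (Finset.univ : Finset s), x i ∈ D := fun i _ => hxD i (hsK i i.2)
  have hD : Convex ℝ D := (hconv _ hne.some_mem).1
  obtain ⟨k, hk, hnn⟩ := h _ (hD.sum_mem hw0 hw1 hxs)
  have h1 := hnn.trans ((hconv k hk).map_sum_le hw0 hw1 hxs)
  have h2 : ∑ i : s, (-p (Pi.single i 1) / P) • F (x i) k
      = (∑ i : s, (-p (Pi.single i 1)) * F (x i) k) / P := by
    rw [Finset.sum_div]
    exact Finset.sum_congr rfl fun i _ => by rw [smul_eq_mul]; ring
  rw [h2] at h1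
  have h3 : (∑ i : s, (-p (Pi.single i 1)) * F (x i) k) / P < 0 :=
    div_neg_of_neg_of_pos (by linarith [hval k hk]) hPpos
  exact absurd h1 (not_le.2 h3)

/-! ### Multipliers for finite-valued convex systems -/

/-- Two weighted points of a convex set can be merged into one, simultaneously for all concave
functions on the set. -/
theorem exists_merge_of_convex {V : Type*} [AddCommGroup V] [Module ℝ V] {U : Set V}
    (hU : Convex ℝ U) {v w : V} (hv : v ∈ U) (hw : w ∈ U) {a b : ℝ} (ha : 0 ≤ a) (hb : 0 ≤ b) :
    ∃ z ∈ U, ∀ h : V → ℝ, ConcaveOn ℝ U h → a * h v + b * h w ≤ (a + b) * h z := by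
  rcases (add_nonneg ha hb).eq_or_lt with h0 | h0
  · refine ⟨v, hv, fun h _ => ?_⟩
    have ha0 : a = 0 := by linarith
    have hb0 : b = 0 := by linarith
    simp [ha0, hb0]
  · have hab : a / (a + b) + b / (a + b) = 1 := by rw [← add_div, div_self h0.ne']
    refine ⟨(a / (a + b)) • v + (b / (a + b)) • w,
      hU hv hw (div_nonneg ha h0.le) (div_nonneg hb h0.le) hab, fun h hh => ?_⟩
    have h1 := mul_le_mul_of_nonneg_left
      (hh.2 hv hw (div_nonneg ha h0.le) (div_nonneg hb h0.le) hab) h0.le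
    refine le_of_eq_of_le ?_ h1
    simp only [smul_eq_mul]
    field_simp

/-- A nonnegative continuous weight times an upper semicontinuous function is upper
semicontinuous. -/
theorem upperSemicontinuousOn_mul {Y Z : Type*} [TopologicalSpace Y] [TopologicalSpace Z]
    {K : Set Y} {U : Set Z} {a : Y → ℝ} {v : Y → Z} {h : Z → ℝ}
    (ha : Continuous a) (hv : Continuous v) (ha0 : ∀ k ∈ K, 0 ≤ a k) (hvU : MapsTo v K U)
    (hh : UpperSemicontinuousOn h U) :
    UpperSemicontinuousOn (fun k => a k * h (v k)) K := by
  intro k hk y hy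
  -- Replacing the `h` factor by a constant `c` just above `h (v k)` leaves only the continuous
  -- weight to control, whatever the sign of `h`.
  obtain ⟨c, hc, hcy⟩ : ∃ c, h (v k) < c ∧ a k * c < y := by
    have hlim : Tendsto (fun c => a k * c) (𝓝[>] (h (v k))) (𝓝 (a k * h (v k))) :=
      ((continuous_const_mul (a k)).tendsto _).mono_left nhdsWithin_le_nhds
    exact (eventually_mem_nhdsWithin.and (hlim.eventually_lt_const hy)).exists
  have h1 : ∀ᶠ k' in 𝓝[K] k, h (v k') < c :=
    (hv.continuousWithinAt.tendsto_nhdsWithin hvU).eventually (hh (v k) (hvU hk) c hc)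
  have h2 : ∀ᶠ k' in 𝓝[K] k, a k' * c < y :=
    (((ha.mul continuous_const).tendsto k).mono_left nhdsWithin_le_nhds).eventually_lt_const hcy
  filter_upwards [h1, h2, self_mem_nhdsWithin] with k' h1 h2 hk'
  exact (mul_le_mul_of_nonneg_left h1.le (ha0 k' hk')).trans_lt h2

/-- Existence of a Lagrange multiplier and a scenario for finite-valued robust convex systems. -/
theorem exists_multiplier {X : Type*} [AddCommGroup X] [Module ℝ X]
    {T : Type*} [Fintype T] {E : T → Type*} [∀ t, AddCommGroup (E t)] [∀ t, Module ℝ (E t)]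
    [∀ t, TopologicalSpace (E t)] {D : Set X} {φ : X → ℝ} {U : ∀ t, Set (E t)}
    {G : ∀ t, X → E t → ℝ}
    (hU : ∀ t, IsCompact (U t)) (hUne : ∀ t, (U t).Nonempty) (hUc : ∀ t, Convex ℝ (U t))
    (hφ : ConvexOn ℝ D φ) (hG : ∀ t, ∀ v ∈ U t, ConvexOn ℝ D (fun x => G t x v))
    (hGc : ∀ t, ∀ x ∈ D, ConcaveOn ℝ (U t) (G t x))
    (hGu : ∀ t, ∀ x ∈ D, UpperSemicontinuousOn (G t x) (U t))
    (halt : ∀ x ∈ D, 0 ≤ φ x ∨ ∃ t, ∃ v ∈ U t, 0 ≤ G t x v)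
    (hSlater : ∀ u : ∀ t, E t, (∀ t, u t ∈ U t) → ∃ x ∈ D, ∀ t, G t x (u t) < 0) :
    ∃ (lam : T → ℝ) (u : ∀ t, E t), (∀ t, 0 ≤ lam t) ∧ (∀ t, u t ∈ U t) ∧
      ∀ x ∈ D, 0 ≤ φ x + ∑ t, lam t * G t x (u t) := by
  classical
  choose u₀ hu₀ using hUne
  -- The index `none` carries the weight of the objective, `some t` that of constraint `t`.
  let K : Set ((Option T → ℝ) × (∀ t, E t)) := stdSimplex ℝ (Option T) ×ˢ Set.pi univ U
  let F : X → (Option T → ℝ) × (∀ t, E t) → ℝ := fun x k =>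
    k.1 none * φ x + ∑ t, k.1 (some t) * G t x (k.2 t)
  have hK : IsCompact K := (isCompact_stdSimplex ℝ _).prod (isCompact_univ_pi hU)
  have hne : K.Nonempty := ⟨(Pi.single none 1, u₀), single_mem_stdSimplex ℝ _, fun t _ => hu₀ t⟩
  obtain ⟨⟨q, u⟩, ⟨hq, hu⟩, hqu⟩ := exists_forall_nonneg_of_concavelike (D := D) (F := F) hK hne
    (by
      rintro ⟨q, u⟩ ⟨hq, hu⟩
      refine (hφ.smul (hq.1 none)).add ?_
      have : ∀ s : Finset T, ConvexOn ℝ D (fun x => ∑ t ∈ s, q (some t) * G t x (u t)) := by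
        intro s
        induction s using Finset.induction_on with
        | empty => simpa using convexOn_const (0 : ℝ) hφ.1
        | insert t s hts ih =>
          simp only [Finset.sum_insert hts]
          exact ((hG t (u t) (hu t trivial)).smul (hq.1 (some t))).add ih
      exact this _)
    (by
      intro x hx
      refine UpperSemicontinuousOn.add (ContinuousOn.upperSemicontinuousOn ?_)
        (upperSemicontinuousOn_sum fun t _ => ?_)
      · fun_prop
      · exact upperSemicontinuousOn_mul (K := K) (a := fun k => k.1 (some t))
          (v := fun k => k.2 t) (by fun_prop) (by fun_prop) (fun k hk => hk.1.1 _) (fun k hk => hk.2 t trivial)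
          (hGu t x hx))
    (by
      rintro ⟨q, u⟩ ⟨hq, hu⟩ ⟨q', u'⟩ ⟨hq', hu'⟩ a b ha hb hab
      choose z hzU hz using fun t => exists_merge_of_convex (hUc t) (hu t trivial) (hu' t trivial)
        (mul_nonneg ha (hq.1 (some t))) (mul_nonneg hb (hq'.1 (some t)))
      refine ⟨(a • q + b • q', z), ⟨convex_stdSimplex ℝ _ hq hq' ha hb hab, fun t _ => hzU t⟩,
        fun x hx => ?_⟩
      have h1 : ∑ t, (a * q (some t) * G t x (u t) + b * q' (some t) * G t x (u' t))
          ≤ ∑ t, (a * q (some t) + b * q' (some t)) * G t x (z t) :=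
        Finset.sum_le_sum fun t _ => hz t (G t x) (hGc t x hx)
      simp only [F, Pi.add_apply, Pi.smul_apply, smul_eq_mul, mul_add, Finset.mul_sum]
      rw [Finset.sum_add_distrib] at h1
      simp only [mul_assoc] at h1 ⊢
      linarith)
    (by
      intro x hx
      rcases halt x hx with h0 | ⟨t, v, hv, h0⟩
      · refine ⟨(Pi.single none 1, u₀), ⟨single_mem_stdSimplex ℝ _, fun t _ => hu₀ t⟩, ?_⟩
        simpa [F] using h0
      · refine ⟨(Pi.single (some t) 1, Function.update u₀ t v),
          ⟨single_mem_stdSimplex ℝ _, fun s _ => ?_⟩, ?_⟩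
        · by_cases hst : s = t
          · subst hst
            simpa using hv
          · simpa [hst] using hu₀ s
        · simp only [F]
          rw [Finset.sum_eq_single t (fun s _ hst => by simp [hst]) (by simp)]
          simpa using h0)
  replace hq : q ∈ stdSimplex ℝ (Option T) := hq
  -- With zero objective weight, nonnegativity at the Slater point of `u` forces every constraint
  -- weight to vanish, yet the weights sum to one.
  have hpos : 0 < q none := by
    refine (hq.1 none).lt_of_ne' fun h0 => ?_
    obtain ⟨x, hx, hneg⟩ := hSlater u fun t => hu t trivial
    have h1 : 0 ≤ q none * φ x + ∑ t, q (some t) * G t x (u t) := hqu x hx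
    rw [h0, zero_mul, zero_add] at h1
    have h2 := hq.2
    rw [Fintype.sum_option, h0, zero_add] at h2
    have hterm : ∀ t ∈ Finset.univ, q (some t) * G t x (u t) ≤ 0 := fun t _ =>
      mul_nonpos_of_nonneg_of_nonpos (hq.1 _) (hneg t).le
    have h3 := (Finset.sum_eq_zero_iff_of_nonpos hterm).1
      (le_antisymm (Finset.sum_nonpos hterm) h1)
    have h4 : ∑ t, q (some t) = 0 := Finset.sum_eq_zero fun t ht =>
      (mul_eq_zero.1 (h3 t ht)).resolve_right (hneg t).ne
    exact one_ne_zero (h2.symm.trans h4)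
  refine ⟨fun t => q (some t) / q none, u, fun t => div_nonneg (hq.1 _) hpos.le,
    fun t => hu t trivial, fun x hx => ?_⟩
  have h1 := div_nonneg (hqu x hx) hpos.le
  refine h1.trans_eq ?_
  simp only [F]
  rw [add_div, mul_div_cancel_left₀ _ hpos.ne', Finset.sum_div]
  exact congrArg _ (Finset.sum_congr rfl fun t _ => by ring)

/-! ### Passage from extended-real to real values -/

/-- Where `f` is finite, the graph points lie in the epigraph, whose convexity is then Jensen's
inequality. Finiteness on `S` matters because `toReal` sends `⊤` to `0`. -/
theorem GammaOn.convexOn_toReal {V : Type*} [AddCommGroup V] [Module ℝ V] [TopologicalSpace V]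
    {D S : Set V} {f : V → EReal} (hf : GammaOn D f) (hS : Convex ℝ S) (hSD : S ⊆ D)
    (htop : ∀ x ∈ S, f x ≠ ⊤) : ConvexOn ℝ S (fun x => (f x).toReal) := by
  have hcoe : ∀ x ∈ S, ((f x).toReal : EReal) = f x := fun x hx =>
    EReal.coe_toReal (htop x hx) (hf.ne_bot x (hSD hx))
  refine ⟨hS, fun x hx y hy a b ha hb hab => ?_⟩
  have h1 := (hf.convex_epi (x := (x, (f x).toReal)) ⟨hSD hx, (hcoe x hx).ge⟩
    (y := (y, (f y).toReal)) ⟨hSD hy, (hcoe y hy).ge⟩ ha hb hab).2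
  have hz := hcoe _ (hS hx hy ha hb hab)
  simp only [Prod.smul_mk, Prod.mk_add_mk] at h1
  rw [← hz, EReal.coe_le_coe_iff] at h1
  exact h1

theorem GammaOn.convex_dom {V : Type*} [AddCommGroup V] [Module ℝ V] [TopologicalSpace V]
    {f : V → EReal} (hf : GammaOn univ f) : Convex ℝ (dom f) := by
  intro x hx y hy a b ha hb hab
  have hcoe : ∀ x ∈ dom f, ((f x).toReal : EReal) = f x := fun x hx =>
    EReal.coe_toReal hx (hf.ne_bot x trivial)
  have h1 := (hf.convex_epi (x := (x, (f x).toReal)) ⟨trivial, (hcoe x hx).ge⟩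
    (y := (y, (f y).toReal)) ⟨trivial, (hcoe y hy).ge⟩ ha hb hab).2
  exact ne_top_of_le_ne_top (EReal.coe_ne_top _) h1

theorem sum_ne_bot {T : Type*} (s : Finset T) {h : T → EReal} (hh : ∀ t ∈ s, h t ≠ ⊥) :
    ∑ t ∈ s, h t ≠ ⊥ := by
  classical
  induction s using Finset.induction_on with
  | empty => simp
  | insert t s hts ih =>
    rw [Finset.sum_insert hts]
    simp only [Finset.mem_insert, forall_eq_or_imp] at hh
    exact EReal.add_ne_bot_iff.2 ⟨hh.1, ih hh.2⟩

theorem coe_sum {T : Type*} (s : Finset T) (h : T → ℝ) :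
    ((∑ t ∈ s, h t : ℝ) : EReal) = ∑ t ∈ s, (h t : EReal) := by
  classical
  induction s using Finset.induction_on with
  | empty => simp
  | insert t s hts ih => rw [Finset.sum_insert hts, Finset.sum_insert hts, EReal.coe_add, ih]

end RobustConvex

/-! ### Robust strong stable duality -/

theorem corollary7p4
    {X : Type*} [AddCommGroup X] [Module ℝ X] [TopologicalSpace X] [IsTopologicalAddGroup X]
    [ContinuousSMul ℝ X] [LocallyConvexSpace ℝ X] [T2Space X]
    {T : Type*} [Fintype T]
    {E : T → Type*} [∀ t, AddCommGroup (E t)] [∀ t, Module ℝ (E t)]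
    [∀ t, TopologicalSpace (E t)] [∀ t, IsTopologicalAddGroup (E t)]
    [∀ t, ContinuousSMul ℝ (E t)]
    (f : X → EReal) (hf : RobustConvex.GammaOn Set.univ f)
    (C : Set X) (hC_ne : C.Nonempty) (hC_closed : IsClosed C) (hC_convex : Convex ℝ C)
    (U : ∀ t, Set (E t)) (hU_compact : ∀ t, IsCompact (U t)) (hU_convex : ∀ t, Convex ℝ (U t))
    (g : ∀ t, X → E t → EReal)
    (hg : ∀ t, ∀ v ∈ U t, RobustConvex.GammaOn Set.univ (fun x => g t x v))
    (hg_concave : ∀ t, ∀ x ∈ C ∩ RobustConvex.dom f,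
      RobustConvex.GammaOn (U t) (fun v => -g t x v))
    (hA : (RobustConvex.feasibleSet C U g ∩ RobustConvex.dom f).Nonempty)
    (hSlater : ∀ u : ∀ t, E t, (∀ t, u t ∈ U t) →
      ∃ x ∈ C ∩ RobustConvex.dom f, ∀ t, g t x (u t) < 0) :
    RobustConvex.RobustStrongStableDuality f C U g := by
  set D : Set X := C ∩ RobustConvex.dom f
  obtain ⟨x₀, hx₀A, hx₀f⟩ := hA
  have hx₀D : x₀ ∈ D := ⟨hx₀A.1, hx₀f⟩
  have hUne : ∀ t, (U t).Nonempty := fun t =>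
    let ⟨v, hv, _⟩ := (hg_concave t x₀ hx₀D).dom_nonempty
    ⟨v, hv⟩
  have hfcoe : ∀ x ∈ D, ((f x).toReal : EReal) = f x := fun x hx =>
    EReal.coe_toReal hx.2 (hf.ne_bot x trivial)
  have hgtop : ∀ t, ∀ x ∈ D, ∀ v ∈ U t, g t x v ≠ ⊤ := fun t x hx v hv h =>
    (hg_concave t x hx).ne_bot v hv (by simp [h])
  have hgbot : ∀ t x, ∀ v ∈ U t, g t x v ≠ ⊥ := fun t x v hv => (hg t v hv).ne_bot x trivial
  have hgcoe : ∀ t, ∀ x ∈ D, ∀ v ∈ U t, ((g t x v).toReal : EReal) = g t x v :=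
    fun t x hx v hv => EReal.coe_toReal (hgtop t x hx v hv) (hgbot t x v hv)
  have hDc : Convex ℝ D := hC_convex.inter hf.convex_dom
  intro xs
  have hweak : ∀ (lam : T → ℝ) (u : ∀ t, E t), (∀ t, 0 ≤ lam t) → (∀ t, u t ∈ U t) →
      RobustConvex.dualObjective f C g xs lam u ≤ RobustConvex.primalValue f C U g xs := by
    intro lam u hlam hu
    refine le_iInf₂ fun x hx => (iInf₂_le x hx.1).trans ?_
    have hsum : ∑ t, ((lam t : ℝ) : EReal) * g t x (u t) ≤ 0 :=
      Finset.sum_nonpos fun t _ => EReal.mul_nonpos_iff.2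
        (Or.inl ⟨EReal.coe_nonneg.2 (hlam t), hx.2 t (u t) (hu t)⟩)
    exact (add_le_add le_rfl hsum).trans_eq (add_zero _)
  suffices hmax : ∃ (lam : T → ℝ) (u : ∀ t, E t), (∀ t, 0 ≤ lam t) ∧ (∀ t, u t ∈ U t) ∧
      RobustConvex.primalValue f C U g xs ≤ RobustConvex.dualObjective f C g xs lam u by
    obtain ⟨lam, u, hlam, hu, hle⟩ := hmax
    refine ⟨⟨lam, u, hlam, hu, hle.antisymm (hweak lam u hlam hu)⟩, ?_⟩
    rintro d ⟨lam, u, hlam, hu, rfl⟩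
    exact hweak lam u hlam hu
  rcases eq_or_ne (RobustConvex.primalValue f C U g xs) ⊥ with hbot | hbot
  · choose u hu using hUne
    exact ⟨0, u, fun _ => le_rfl, hu, hbot ▸ bot_le⟩
  have hprimal_le : ∀ x ∈ D, x ∈ RobustConvex.feasibleSet C U g →
      RobustConvex.primalValue f C U g xs ≤ (((f x).toReal - xs x : ℝ) : EReal) := by
    intro x hx hxA
    rw [EReal.coe_sub, hfcoe x hx]
    exact iInf₂_le x hxA
  have htop : RobustConvex.primalValue f C U g xs ≠ ⊤ :=
    ne_top_of_le_ne_top (EReal.coe_ne_top _) (hprimal_le x₀ hx₀D hx₀A)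
  lift RobustConvex.primalValue f C U g xs to ℝ using ⟨htop, hbot⟩ with m
  -- On `D` all the data are real: properness of `-g t x ·` excludes `⊤` for `g`, and properness of
  -- `g t · v` excludes `⊥`.
  obtain ⟨lam, u, hlam, hu, hnn⟩ := RobustConvex.exists_multiplier (D := D)
    (φ := fun x => (f x).toReal + (-xs x + -m)) (G := fun t x v => (g t x v).toReal)
    hU_compact hUne hU_convex
    ((hf.convexOn_toReal hDc (Set.subset_univ _) fun x hx => hx.2).add
      (((-xs).toLinearMap.convexOn hDc).add (convexOn_const _ hDc)))
    (fun t v hv => (hg t v hv).convexOn_toReal hDc (Set.subset_univ _)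
      fun x hx => hgtop t x hx v hv)
    (fun t x hx => by
      have h1 := (hg_concave t x hx).convexOn_toReal (hU_convex t) subset_rfl fun v hv => by
        simpa using hgbot t x v hv
      refine neg_convexOn_iff.1 (h1.congr fun v hv => ?_)
      simp)
    (fun t x hx v hv y hy => by
      have h1 : -(y : EReal) < -g t x v := by
        rw [EReal.neg_lt_neg_iff, ← hgcoe t x hx v hv]
        exact EReal.coe_lt_coe_iff.2 hy
      filter_upwards [(hg_concave t x hx).lsc v hv _ h1, self_mem_nhdsWithin] with v' h2 hv'
      rw [gt_iff_lt, EReal.neg_lt_neg_iff, ← hgcoe t x hx v' hv'] at h2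
      exact EReal.coe_lt_coe_iff.1 h2)
    (fun x hx => by
      by_cases hxA : x ∈ RobustConvex.feasibleSet C U g
      · have := EReal.coe_le_coe_iff.1 (hprimal_le x hx hxA)
        left
        linarith
      · right
        have h1 : ∃ t, ∃ v ∈ U t, 0 < g t x v := by
          by_contra! h
          exact hxA ⟨hx.1, h⟩
        obtain ⟨t, v, hv, hpos⟩ := h1
        exact ⟨t, v, hv, EReal.toReal_nonneg hpos.le⟩)
    (fun u hu => by
      obtain ⟨x, hx, hneg⟩ := hSlater u hu
      refine ⟨x, hx, fun t => ?_⟩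
      have h1 := hneg t
      rw [← hgcoe t x hx (u t) (hu t)] at h1
      exact EReal.coe_neg'.1 h1)
  refine ⟨lam, u, hlam, hu, le_iInf₂ fun x hxC => ?_⟩
  -- Outside `dom f` the Lagrangian is `⊤`: no term of the sum is `⊥`, also when `g` is `⊤`, since
  -- `0 * ⊤ = 0`.
  by_cases hxf : f x = ⊤
  · rw [hxf, EReal.top_sub_coe, EReal.top_add_of_ne_bot]
    · exact le_top
    · refine RobustConvex.sum_ne_bot _ fun t _ => ?_
      rcases (hlam t).eq_or_lt with h0 | h0
      · simp [← h0]
      · have := hgbot t x (u t) (hu t)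
        induction hgt : g t x (u t) with
        | bot => exact absurd hgt this
        | coe r => rw [← EReal.coe_mul]; exact EReal.coe_ne_bot _
        | top => rw [EReal.coe_mul_top_of_pos h0]; exact top_ne_bot
  · have hx : x ∈ D := ⟨hxC, hxf⟩
    have h1 := hnn x hx
    have h2 : ∑ t, ((lam t : ℝ) : EReal) * g t x (u t)
        = ((∑ t, lam t * (g t x (u t)).toReal : ℝ) : EReal) := by
      rw [RobustConvex.coe_sum]
      refine Finset.sum_congr rfl fun t _ => ?_
      rw [EReal.coe_mul, hgcoe t x hx (u t) (hu t)]
    rw [h2, ← hfcoe x hx, ← EReal.coe_sub, ← EReal.coe_add, EReal.coe_le_coe_iff]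
    linarith
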